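/- There exist a finite alphabet $A$ and a finite set $R \subseteq A^* \times A^*$ of defining relations that is homogeneous (that is, $|u| = |v|$ for every $(u,v) \in R$) such that the $o$-conjugacy problem of the monoid $M = \langle A \mid R\rangle$ is undecidable. That is, there is no algorithm that takes as input two words over $A$ and decides whether the elements of $M$ that they represent are $o$-conjugate. Here elements $x, y$ of a monoid $M$ are $o$-conjugate, written $x \sim_o y$, if there exist $g, h \in M$ with $xg = gy$ and $hx = yh$. -/

import Mathlib

/-- `o`-conjugacy in a monoid `M`: `x g = g y` and `h x = y h` for some `g, h` in `M`.
(For a semigroup `S` one takes `g, h` in `S` with an identity adjoined; a monoid already has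
an identity, and a second one would act on both equations in the same way.) -/
def OConjugate {M : Type*} [Monoid M] (x y : M) : Prop :=
  ∃ g h : M, x * g = g * y ∧ h * x = y * h

/-- A set `R` of defining relations over the alphabet `A` is homogeneous if the two sides of
each relation have the same length. -/
def HomogeneousRels {A : Type*} (R : Set (FreeMonoid A × FreeMonoid A)) : Prop :=
  ∀ u v : FreeMonoid A, (u, v) ∈ R → u.length = v.length

/-- The monoid presented by the alphabet `A` and the set `R` of defining relations: the quotient
of the free monoid on `A` by the congruence generated by `R`. -/
abbrev MonoidOfPresentation {A : Type*} (R : Set (FreeMonoid A × FreeMonoid A)) : Type _ :=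
  PresentedMonoid (fun u v : FreeMonoid A => (u, v) ∈ R)

/-- The element of the presented monoid that is represented by a word over the alphabet. -/
def wordClass {A : Type*} (R : Set (FreeMonoid A × FreeMonoid A)) (w : List A) :
    MonoidOfPresentation R :=
  PresentedMonoid.mk (fun u v : FreeMonoid A => (u, v) ∈ R) (FreeMonoid.ofList w)

/-- The `o`-conjugacy problem of a presentation, as a predicate on pairs of words. -/
def OConjugacyProblem {A : Type*} (R : Set (FreeMonoid A × FreeMonoid A))
    (p : List A × List A) : Prop :=
  OConjugate (wordClass R p.1) (wordClass R p.2)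

/-! Halting reduces to the word problem of a finite, not necessarily homogeneous, presentation, and
that word problem reduces to `o`-conjugacy in a homogeneous one. For the second reduction, add a
central letter p and a free separator s, and turn each relation u = v into u p^|v| = v p^|u|.
Compare x = s u p^|v| with y = s v p^|u|. If u = v in the original monoid, then u p^i = v p^j for
some i, j; homogeneity forces |u| + i = |v| + j, so x p^i = y p^i, and the central element p^i
serves as both conjugators. Conversely, forget p and let the padded monoid act on lists of original
elements, with s opening a new entry. Applying xg = gy to [1] yields u :: ks = ks ++ [v], hence u =
v. This is `oConjugate_comparisonWord_iff`. For the first reduction, `wordClass_eq_halted_iff`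
encodes a stack machine: its steps are relations, and a halted state absorbs the stacks. Relations
can also be used backwards, so soundness rests on an invariant: an action on predicates of the
stacks under which a configuration word evaluates to whether it halts. -/

/-- Renaming the letters in a set of defining relations. -/
def renameRels {A B : Type*} (e : A → B) (R : Set (FreeMonoid A × FreeMonoid A)) :
    Set (FreeMonoid B × FreeMonoid B) :=
  Prod.map (FreeMonoid.map e) (FreeMonoid.map e) '' R

theorem HomogeneousRels.rename {A B : Type*} (e : A → B) {R : Set (FreeMonoid A × FreeMonoid A)}
    (hR : HomogeneousRels R) : HomogeneousRels (renameRels e R) := by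
  rintro _ _ ⟨⟨u, v⟩, h, hp⟩
  obtain ⟨rfl, rfl⟩ := Prod.mk.inj hp
  have := hR u v h
  simpa [FreeMonoid.length, FreeMonoid.toList_map] using! this

theorem Function.End.mul_apply {X : Type*} (f g : Function.End X) (x : X) :
    (f * g) x = f (g x) := rfl

theorem FreeMonoid.lift_eq_comp_map {A B M : Type*} [Monoid M] (e : A → B) (f : B → M)
    (w : FreeMonoid A) : FreeMonoid.lift f (FreeMonoid.map e w) = FreeMonoid.lift (f ∘ e) w := by
  induction w using FreeMonoid.inductionOn' with
  | one => simp
  | of_mul a w ih => simp [ih]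

theorem PresentedMonoid.lift_of_eq_mk {A : Type*} (r : FreeMonoid A → FreeMonoid A → Prop)
    (w : FreeMonoid A) : FreeMonoid.lift (PresentedMonoid.of r) w = PresentedMonoid.mk r w := by
  induction w using FreeMonoid.inductionOn' with
  | one => simp
  | of_mul a w ih => simp [ih, PresentedMonoid.of]

/-- The homomorphism of presented monoids given by renaming the letters. -/
def renameHom {A B : Type*} (e : A → B) (R : Set (FreeMonoid A × FreeMonoid A)) :
    MonoidOfPresentation R →* MonoidOfPresentation (renameRels e R) :=
  PresentedMonoid.lift (fun a => PresentedMonoid.of _ (e a)) fun u v h => by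
    have key := PresentedMonoid.mk_eq_mk_of_rel
      (rels := fun u v => (u, v) ∈ renameRels e R) (x := FreeMonoid.map e u)
      (y := FreeMonoid.map e v) ⟨(u, v), h, rfl⟩
    rwa [← PresentedMonoid.lift_of_eq_mk, ← PresentedMonoid.lift_of_eq_mk,
      FreeMonoid.lift_eq_comp_map, FreeMonoid.lift_eq_comp_map] at key

theorem renameHom_wordClass {A B : Type*} (e : A → B) (R : Set (FreeMonoid A × FreeMonoid A))
    (w : List A) : renameHom e R (wordClass R w) = wordClass (renameRels e R) (w.map e) := by
  exact (FreeMonoid.lift_eq_comp_map e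
    (PresentedMonoid.of fun u v => (u, v) ∈ renameRels e R) (FreeMonoid.ofList w)).symm.trans
      (PresentedMonoid.lift_of_eq_mk _ _)

/-- Renaming the letters along a bijection does not change the presented monoid. -/
def renameEquiv {A B : Type*} (e : A ≃ B) (R : Set (FreeMonoid A × FreeMonoid A)) :
    MonoidOfPresentation R ≃* MonoidOfPresentation (renameRels e R) :=
  MonoidHom.toMulEquiv (renameHom e R)
    (PresentedMonoid.lift (fun b => PresentedMonoid.of _ (e.symm b)) (by
      rintro _ _ ⟨⟨u, v⟩, h, hp⟩
      obtain ⟨rfl, rfl⟩ := Prod.mk.inj hp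
      have key := PresentedMonoid.mk_eq_mk_of_rel (rels := fun u v => (u, v) ∈ R) h
      rw [FreeMonoid.lift_eq_comp_map, FreeMonoid.lift_eq_comp_map]
      simp only [Function.comp_def, Equiv.symm_apply_apply]
      rwa [PresentedMonoid.lift_of_eq_mk, PresentedMonoid.lift_of_eq_mk]))
    (by ext x; simp [renameHom])
    (by ext x; simp [renameHom])

theorem OConjugate.map {M N : Type*} [Monoid M] [Monoid N] (f : M →* N) {x y : M}
    (h : OConjugate x y) : OConjugate (f x) (f y) := by
  obtain ⟨g, h, hg, hh⟩ := h
  exact ⟨f g, f h, by rw [← map_mul, hg, map_mul], by rw [← map_mul, hh, map_mul]⟩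

theorem oConjugate_rename_iff {A B : Type*} (e : A ≃ B) (R : Set (FreeMonoid A × FreeMonoid A))
    (u v : List A) :
    OConjugate (wordClass (renameRels e R) (u.map e)) (wordClass (renameRels e R) (v.map e)) ↔
      OConjugate (wordClass R u) (wordClass R v) := by
  rw [← renameHom_wordClass, ← renameHom_wordClass]
  refine ⟨fun h => ?_, fun h => h.map _⟩
  have hinv (x) : (renameEquiv e R).symm (renameHom e R x) = x :=
    (renameEquiv e R).symm_apply_apply x
  rw [← hinv (wordClass R u), ← hinv (wordClass R v)]
  exact h.map (renameEquiv e R).symm.toMonoidHom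

/-! ### Padding: from the word problem to `o`-conjugacy in a homogeneous monoid. -/

section Padding

variable {A : Type*}

/-- The inclusion of the words over `A` into the words over `A` with two extra letters. -/
def padIncl : FreeMonoid A →* FreeMonoid (Option (Option A)) := FreeMonoid.map (some ∘ some)

/-- The padding of a set of relations: the letter `none` is central and makes up for
differences in length; the letter `some none` is a separator that occurs in no other relation. -/
def paddedRels (R : Set (FreeMonoid A × FreeMonoid A)) :
    Set (FreeMonoid (Option (Option A)) × FreeMonoid (Option (Option A))) :=
  Set.range (fun b => (FreeMonoid.of none * FreeMonoid.of b, FreeMonoid.of b * FreeMonoid.of none))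
    ∪ (fun q => (padIncl q.1 * FreeMonoid.of none ^ q.2.length,
        padIncl q.2 * FreeMonoid.of none ^ q.1.length)) '' R

theorem paddedRels_finite [Finite A] {R : Set (FreeMonoid A × FreeMonoid A)} (hR : R.Finite) :
    (paddedRels R).Finite :=
  (Set.finite_range _).union (hR.image _)

theorem FreeMonoid.length_pow {B : Type*} (w : FreeMonoid B) (n : ℕ) :
    (w ^ n).length = n * w.length := by
  induction n with
  | zero => simp
  | succ n ih => rw [pow_succ, FreeMonoid.length_mul, ih]; ring

theorem length_padIncl (w : FreeMonoid A) : (padIncl w).length = w.length := by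
  simp [padIncl, FreeMonoid.length, FreeMonoid.toList_map]

theorem paddedRels_homogeneous (R : Set (FreeMonoid A × FreeMonoid A)) :
    HomogeneousRels (paddedRels R) := by
  rintro _ _ (⟨b, h⟩ | ⟨⟨u, v⟩, -, h⟩)
  · obtain ⟨rfl, rfl⟩ := Prod.mk.inj h
    simp [FreeMonoid.length_mul]
  · obtain ⟨rfl, rfl⟩ := Prod.mk.inj h
    simp [FreeMonoid.length_mul, FreeMonoid.length_pow, length_padIncl, add_comm]

theorem HomogeneousRels.length_eq {R : Set (FreeMonoid A × FreeMonoid A)} (hR : HomogeneousRels R)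
    {u v : FreeMonoid A} (h : conGen (fun u v => (u, v) ∈ R) u v) : u.length = v.length := by
  induction h with
  | of u v h => exact hR u v h
  | refl => rfl
  | symm _ ih => exact ih.symm
  | trans _ _ ih₁ ih₂ => exact ih₁.trans ih₂
  | mul _ _ ih₁ ih₂ => rw [FreeMonoid.length_mul, FreeMonoid.length_mul, ih₁, ih₂]

variable (R : Set (FreeMonoid A × FreeMonoid A))

/-- The quotient map onto the padded monoid. -/
abbrev padMk : FreeMonoid (Option (Option A)) →* MonoidOfPresentation (paddedRels R) :=
  PresentedMonoid.mk _

/-- The padding letter, as an element of the padded monoid. -/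
abbrev pad : MonoidOfPresentation (paddedRels R) := padMk R (FreeMonoid.of none)

theorem pad_commute (x : MonoidOfPresentation (paddedRels R)) : Commute (pad R) x := by
  obtain ⟨w, rfl⟩ := PresentedMonoid.surjective_mk x
  induction w using FreeMonoid.inductionOn' with
  | one => exact Commute.one_right _
  | of_mul a w ih =>
    rw [map_mul]
    refine Commute.mul_right ?_ ih
    exact PresentedMonoid.mk_eq_mk_of_rel (rels := fun u v => (u, v) ∈ paddedRels R)
      (x := .of none * .of a) (y := .of a * .of none) (Or.inl ⟨a, rfl⟩)

/-- Since padding is central, the powers collected at each use of a relation can be moved to the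
right end. -/
theorem exists_pad_of_conGen {u v : FreeMonoid A} (h : conGen (fun u v => (u, v) ∈ R) u v) :
    ∃ i j, padMk R (padIncl u) * pad R ^ i = padMk R (padIncl v) * pad R ^ j := by
  induction h with
  | of u v h =>
    refine ⟨v.length, u.length, ?_⟩
    rw [← map_pow, ← map_mul, ← map_pow, ← map_mul]
    exact PresentedMonoid.mk_eq_mk_of_rel (rels := fun u v => (u, v) ∈ paddedRels R)
      (Or.inr ⟨(u, v), h, rfl⟩)
  | refl => exact ⟨0, 0, rfl⟩
  | symm _ ih => obtain ⟨i, j, h⟩ := ih; exact ⟨j, i, h.symm⟩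
  | trans _ _ ih₁ ih₂ =>
    obtain ⟨i, j, h⟩ := ih₁
    obtain ⟨k, l, h'⟩ := ih₂
    refine ⟨i + k, l + j, ?_⟩
    rw [pow_add, ← mul_assoc, h, mul_assoc, ← pow_add, add_comm, pow_add, ← mul_assoc, h',
      mul_assoc, ← pow_add]
  | mul _ _ ih₁ ih₂ =>
    obtain ⟨i, j, h⟩ := ih₁
    obtain ⟨k, l, h'⟩ := ih₂
    refine ⟨i + k, j + l, ?_⟩
    rw [map_mul, map_mul, map_mul, map_mul, pow_add, pow_add,
      Commute.mul_mul_mul_comm ((pad_commute R _).pow_left i).symm,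
      Commute.mul_mul_mul_comm ((pad_commute R _).pow_left j).symm, h, h']

theorem modifyHead_append {K : Type*} (f : K → K) {l : List K} (hl : l ≠ []) (m : List K) :
    (l ++ m).modifyHead f = l.modifyHead f ++ m := by
  cases l with
  | nil => exact absurd rfl hl
  | cons => rfl

/-- The action of the padded monoid on lists of elements of the original one: the separator starts
a new list entry, a letter multiplies the first entry, and padding is ignored. -/
def segmentAction : Option (Option A) → Function.End (List (MonoidOfPresentation R))
  | none => 1
  | some none => fun l => 1 :: l
  | some (some a) => fun l => l.modifyHead (PresentedMonoid.of _ a * ·)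

theorem lift_segmentAction_padIncl (w : FreeMonoid A) (l : List (MonoidOfPresentation R)) :
    FreeMonoid.lift (segmentAction R) (padIncl w) l =
      l.modifyHead (PresentedMonoid.mk _ w * ·) := by
  induction w using FreeMonoid.inductionOn' with
  | one => cases l <;> simp [Function.End.one_def]
  | of_mul a w ih =>
    rw [map_mul, map_mul, map_mul, Function.End.mul_apply, ih]
    cases l <;> simp [padIncl, segmentAction, PresentedMonoid.of, mul_assoc]

theorem lift_segmentAction_pad (n : ℕ) :
    FreeMonoid.lift (segmentAction R) (FreeMonoid.of none ^ n) = 1 := by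
  rw [map_pow, FreeMonoid.lift_eval_of]; exact one_pow n

/-- The action `segmentAction`, as a homomorphism from the padded monoid. -/
def segmentHom : MonoidOfPresentation (paddedRels R) →*
    Function.End (List (MonoidOfPresentation R)) :=
  PresentedMonoid.lift (segmentAction R) (by
    rintro _ _ (⟨b, h⟩ | ⟨⟨u, v⟩, huv, h⟩)
    · obtain ⟨rfl, rfl⟩ := Prod.mk.inj h
      simp [segmentAction]
    · obtain ⟨rfl, rfl⟩ := Prod.mk.inj h
      rw [map_mul, map_mul, lift_segmentAction_pad, lift_segmentAction_pad, mul_one, mul_one]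
      funext l
      rw [lift_segmentAction_padIncl, lift_segmentAction_padIncl,
        PresentedMonoid.mk_eq_mk_of_rel (rels := fun u v => (u, v) ∈ R) huv])

/-- Letters act only at the front of a list and never delete an entry. Nonemptiness of `l` keeps the
first entry of `m` untouched. -/
theorem segmentHom_append (g : MonoidOfPresentation (paddedRels R))
    {l : List (MonoidOfPresentation R)} (hl : l ≠ []) (m : List (MonoidOfPresentation R)) :
    segmentHom R g (l ++ m) = segmentHom R g l ++ m ∧ segmentHom R g l ≠ [] := by
  obtain ⟨w, rfl⟩ := PresentedMonoid.surjective_mk g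
  induction w using FreeMonoid.inductionOn' with
  | one => exact ⟨rfl, hl⟩
  | of_mul a w ih =>
    rw [map_mul, map_mul, Function.End.mul_apply, Function.End.mul_apply, ih.1]
    change segmentAction R a _ = segmentAction R a _ ++ _ ∧ segmentAction R a _ ≠ []
    match a with
    | none => exact ⟨rfl, ih.2⟩
    | some none => exact ⟨rfl, by simp [segmentAction]⟩
    | some (some a) => exact ⟨modifyHead_append _ ih.2 _, by simpa [segmentAction] using ih.2⟩

/-- The equation says that each entry equals the next one, so the value `a` propagates to the end.
-/
theorem eq_of_cons_eq_append_singleton {K : Type*} {a b : K} {l : List K}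
    (h : a :: l = l ++ [b]) : a = b := by
  induction l with
  | nil => simpa using h
  | cons c l ih =>
    obtain ⟨rfl, h⟩ := List.cons.inj h
    exact ih h

/-- The word over the padded alphabet that encodes the first of two words to be compared. -/
def comparisonWord (u v : List A) : List (Option (Option A)) :=
  some none :: (u.map (fun a => some (some a)) ++ v.map fun _ => none)

theorem wordClass_comparisonWord (u v : List A) :
    wordClass (paddedRels R) (comparisonWord u v) =
      padMk R (.of (some none)) * (padMk R (padIncl (.ofList u)) * pad R ^ v.length) := by
  rw [← map_pow, ← map_mul, ← map_mul, wordClass]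
  congr 1
  have : (FreeMonoid.of none : FreeMonoid (Option (Option A))) ^ v.length =
      FreeMonoid.ofList (v.map fun _ => none) := by
    induction v with
    | nil => rfl
    | cons a v ih => rw [List.length_cons, pow_succ', ih]; rfl
  rw [this]
  rfl

theorem wordClass_eq_of_oConjugate {u v : List A}
    (h : OConjugate (wordClass (paddedRels R) (comparisonWord u v))
      (wordClass (paddedRels R) (comparisonWord v u))) : wordClass R u = wordClass R v := by
  obtain ⟨g, -, h, -⟩ := h
  -- With `g` sending [1] to k :: ks, the two sides become 1 :: u k :: ks and k :: ks ++ [v]; the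
  -- heads give k = 1.
  have key := congrFun (congrArg (segmentHom R) h) [1]
  rw [wordClass_comparisonWord, wordClass_comparisonWord] at key
  have hpad : segmentHom R (pad R) = 1 := rfl
  have hsep (l) : segmentHom R (padMk R (.of (some none))) l = 1 :: l := rfl
  have hw (w l) : segmentHom R (padMk R (padIncl w)) l =
      l.modifyHead (PresentedMonoid.mk _ w * ·) :=
    lift_segmentAction_padIncl R w l
  simp only [map_mul, map_pow, hpad, one_pow, mul_one, Function.End.mul_apply,
    hsep, hw, List.modifyHead_cons] at key
  obtain ⟨k, ks, hk⟩ := List.exists_cons_of_ne_nil (segmentHom_append R g (l := [1]) (by simp) []).2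
  rw [← List.singleton_append (l := [_]), (segmentHom_append R g (by simp) _).1, hk] at key
  obtain ⟨rfl, h⟩ := List.cons.inj key
  rw [List.modifyHead_cons, mul_one] at h
  exact eq_of_cons_eq_append_singleton h

theorem oConjugate_of_wordClass_eq {u v : List A} (h : wordClass R u = wordClass R v) :
    OConjugate (wordClass (paddedRels R) (comparisonWord u v))
      (wordClass (paddedRels R) (comparisonWord v u)) := by
  obtain ⟨i, j, hij⟩ := exists_pad_of_conGen R (PresentedMonoid.mk_eq_mk_iff.1 h)
  -- The exponents are not explicit, but length is an invariant of the homogeneous padded monoid and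
  -- fixes their difference.
  have hlen : u.length + i = v.length + j := by
    rw [← map_pow, ← map_mul, ← map_pow, ← map_mul] at hij
    simpa [FreeMonoid.length_mul, FreeMonoid.length_pow, length_padIncl] using!
      (paddedRels_homogeneous R).length_eq (PresentedMonoid.mk_eq_mk_iff.1 hij)
  have key : wordClass (paddedRels R) (comparisonWord u v) * pad R ^ i =
      wordClass (paddedRels R) (comparisonWord v u) * pad R ^ i := by
    rw [wordClass_comparisonWord, wordClass_comparisonWord, mul_assoc, mul_assoc _ (_ * _),
      mul_assoc, ← pow_add, add_comm, pow_add, ← mul_assoc (padMk R (padIncl _)), hij,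
      mul_assoc, mul_assoc, ← pow_add, ← pow_add, hlen, add_comm j]
  refine ⟨pad R ^ i, pad R ^ i, ?_, ?_⟩
  · rw [key, ((pad_commute R _).pow_left i).eq]
  · rw [((pad_commute R _).pow_left i).eq, key]

/-- The word problem of a presentation reduces to the `o`-conjugacy problem of its padding. -/
theorem oConjugate_comparisonWord_iff (u v : List A) :
    OConjugate (wordClass (paddedRels R) (comparisonWord u v))
      (wordClass (paddedRels R) (comparisonWord v u)) ↔ wordClass R u = wordClass R v :=
  ⟨wordClass_eq_of_oConjugate R, oConjugate_of_wordClass_eq R⟩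

end Padding

/-! ### The presentation attached to a stack machine. -/

open Function (update)
open Turing

section StackMachine

variable {K : Type*} {Γ : K → Type*} {Λ σ : Type*}

/-- The letters of the presentation attached to a stack machine: `stack k none` is the bottom of
the stack `k`, `stack k (some a)` an entry of it, `state q v` means that the statement `q` is about
to be run with the local variables `v`. -/
inductive StackLetter (T : Set (TM2.Stmt Γ Λ σ)) : Type _
  | stack (k : K) (o : Option (Γ k)) : StackLetter T
  | state (q : T) (v : σ) : StackLetter T
  | halted : StackLetter T

open StackLetter

instance {T : Set (TM2.Stmt Γ Λ σ)} [Finite T] [Finite σ] [Finite K] [∀ k, Finite (Γ k)] :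
    Finite (StackLetter T) := by
  let f : ((Σ k, Option (Γ k)) ⊕ (T × σ)) ⊕ Unit → StackLetter T :=
    Sum.elim (Sum.elim (fun p => stack p.1 p.2) (fun p => state p.1 p.2)) (fun _ => halted)
  refine Finite.of_surjective f ?_
  rintro (⟨k, o⟩ | ⟨q, v⟩ | _)
  exacts [⟨.inl (.inl ⟨k, o⟩), rfl⟩, ⟨.inl (.inr (q, v)), rfl⟩, ⟨.inr (), rfl⟩]

open TM2.Stmt FreeMonoid in
/-- The relations of the presentation attached to a stack machine. Configurations are words in
which the state letter is preceded by the stacks, whose letters commute with each other. -/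
inductive StackRel (M : Λ → TM2.Stmt Γ Λ σ) (T : Set (TM2.Stmt Γ Λ σ)) :
    FreeMonoid (StackLetter T) → FreeMonoid (StackLetter T) → Prop
  | comm (k l : K) (o : Option (Γ k)) (p : Option (Γ l)) (h : k ≠ l) :
      StackRel M T (of (stack k o) * of (stack l p)) (of (stack l p) * of (stack k o))
  | push (k f q h h' v) : StackRel M T
      (of (state ⟨push k f q, h⟩ v)) (of (stack k (some (f v))) * of (state ⟨q, h'⟩ v))
  | peek (k f q h h' v o) : StackRel M T
      (of (stack k o) * of (state ⟨peek k f q, h⟩ v)) (of (stack k o) * of (state ⟨q, h'⟩ (f v o)))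
  | pop (k f q h h' v a) : StackRel M T
      (of (stack k (some a)) * of (state ⟨pop k f q, h⟩ v)) (of (state ⟨q, h'⟩ (f v (some a))))
  | pop_bottom (k f q h h' v) : StackRel M T
      (of (stack k none) * of (state ⟨pop k f q, h⟩ v))
      (of (stack k none) * of (state ⟨q, h'⟩ (f v none)))
  | load (f q h h' v) : StackRel M T (of (state ⟨load f q, h⟩ v)) (of (state ⟨q, h'⟩ (f v)))
  | branch_true (f q₁ q₂ h h' v) (hf : f v = true) : StackRel M T
      (of (state ⟨branch f q₁ q₂, h⟩ v)) (of (state ⟨q₁, h'⟩ v))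
  | branch_false (f q₁ q₂ h h' v) (hf : f v = false) : StackRel M T
      (of (state ⟨branch f q₁ q₂, h⟩ v)) (of (state ⟨q₂, h'⟩ v))
  | goto (f h v h') : StackRel M T (of (state ⟨goto f, h⟩ v)) (of (state ⟨M (f v), h'⟩ v))
  | halt (h v) : StackRel M T (of (state ⟨halt, h⟩ v)) (of halted)
  | absorb (k o) : StackRel M T (of (stack k o) * of halted) (of halted)

/-- The relations `StackRel`, as a set of pairs. -/
def stackRels (M : Λ → TM2.Stmt Γ Λ σ) (T : Set (TM2.Stmt Γ Λ σ)) :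
    Set (FreeMonoid (StackLetter T) × FreeMonoid (StackLetter T)) :=
  {p | StackRel M T p.1 p.2}

theorem stackRels_finite (M : Λ → TM2.Stmt Γ Λ σ) (T : Set (TM2.Stmt Γ Λ σ)) [Finite T] [Finite σ]
    [Finite K] [∀ k, Finite (Γ k)] : (stackRels M T).Finite := by
  have h : {w : FreeMonoid (StackLetter T) | w.length ≤ 2}.Finite :=
    List.finite_length_le (StackLetter T) 2
  refine (h.prod h).subset ?_
  rintro ⟨u, v⟩ (h : StackRel M T u v)
  cases h <;> constructor <;> simp [FreeMonoid.length_mul]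

/-- The letters of a stack, from the bottom to the top. -/
def stackWord (T : Set (TM2.Stmt Γ Λ σ)) (k : K) (l : List (Γ k)) : List (StackLetter T) :=
  stack k none :: l.reverse.map fun a => stack k (some a)

/-- The word for the configuration with stacks `S` that is about to run the statement `q`. -/
def configWord (T : Set (TM2.Stmt Γ Λ σ)) (ks : List K) (q : T) (v : σ) (S : ∀ k, List (Γ k)) :
    List (StackLetter T) :=
  ks.flatMap (fun k => stackWord T k (S k)) ++ [state q v]

/-! ### Soundness: equality with the halted word implies halting. -/

section Soundness

variable [DecidableEq K]

/-- The machine `M` halts when it runs the statement `q` with local variables `v` and stacks `S`. -/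
def HaltsFrom (M : Λ → TM2.Stmt Γ Λ σ) (q : TM2.Stmt Γ Λ σ) (v : σ) (S : ∀ k, List (Γ k)) : Prop :=
  (StateTransition.eval (TM2.step M) (TM2.stepAux q v S)).Dom

theorem haltsFrom_goto (M : Λ → TM2.Stmt Γ Λ σ) (f : σ → Λ) (v : σ) (S : ∀ k, List (Γ k)) :
    HaltsFrom M (.goto f) v S ↔ HaltsFrom M (M (f v)) v S := by
  unfold HaltsFrom
  rw [StateTransition.reaches_eval (f := TM2.step M) (a := TM2.stepAux (.goto f) v S)
    (Relation.ReflTransGen.single (b := TM2.stepAux (M (f v)) v S) rfl)]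

theorem haltsFrom_halt (M : Λ → TM2.Stmt Γ Λ σ) (v : σ) (S : ∀ k, List (Γ k)) :
    HaltsFrom M .halt v S := by
  rw [HaltsFrom, Part.dom_iff_mem]
  exact ⟨_, StateTransition.mem_eval.2 ⟨.refl, rfl⟩⟩

/-- The action of the letters on predicates on the stacks: stack letters push or clear, and a state
letter returns the halting predicate. -/
def stackAction (M : Λ → TM2.Stmt Γ Λ σ) (T : Set (TM2.Stmt Γ Λ σ)) :
    StackLetter T → Function.End ((∀ k, List (Γ k)) → Prop)
  | stack k none => fun P S => P (update S k [])
  | stack k (some a) => fun P S => P (update S k (a :: S k))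
  | state q v => fun _ S => HaltsFrom M q v S
  | halted => fun _ _ => True

/-- Updates of distinct stacks commute, and every other relation is an equivalence between halting
before and after one elementary operation. A stack letter before a state letter fixes the top that
`peek` and `pop` see. -/
theorem stackAction_respects (M : Λ → TM2.Stmt Γ Λ σ) (T : Set (TM2.Stmt Γ Λ σ))
    (u v : FreeMonoid (StackLetter T)) (h : StackRel M T u v) :
    FreeMonoid.lift (stackAction M T) u = FreeMonoid.lift (stackAction M T) v := by
  funext P S
  cases h <;> simp only [map_mul, FreeMonoid.lift_eval_of, Function.End.mul_apply]
  case comm k l o p h =>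
    cases o <;> cases p <;>
      simp [stackAction, Function.update_of_ne h, Function.update_of_ne h.symm,
        Function.update_comm h]
  case peek k f q h h' v o => cases o <;> simp [stackAction, HaltsFrom]
  case goto f h v h' => simpa [stackAction] using haltsFrom_goto M f v S
  case halt => simpa [stackAction] using haltsFrom_halt M _ S
  case absorb k o => cases o <;> simp [stackAction]
  all_goals simp [stackAction, HaltsFrom, *]

/-- The bottom letter erases the old content and the entries are then pushed in order, so the result
does not depend on `S k`. -/
theorem lift_stackAction_stackWord (M : Λ → TM2.Stmt Γ Λ σ) (T : Set (TM2.Stmt Γ Λ σ)) (k : K)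
    (l : List (Γ k)) (P : (∀ k, List (Γ k)) → Prop) (S : ∀ k, List (Γ k)) :
    FreeMonoid.lift (stackAction M T) (.ofList (stackWord T k l)) P S = P (update S k l) := by
  have key : ∀ (l : List (Γ k)) (S : ∀ k, List (Γ k)),
      FreeMonoid.lift (stackAction M T) (.ofList (l.reverse.map fun a => stack k (some a))) P S =
        P (update S k (l ++ S k)) := by
    intro l
    induction l generalizing P with
    | nil => intro S; simp [Function.End.one_def]
    | cons a l ih =>
      intro S
      rw [List.reverse_cons, List.map_append, FreeMonoid.ofList_append, map_mul,
        Function.End.mul_apply, ih]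
      simp [stackAction]
  rw [stackWord, FreeMonoid.ofList_cons, map_mul, Function.End.mul_apply, FreeMonoid.lift_eval_of]
  change FreeMonoid.lift (stackAction M T) _ P (update S k []) = _
  rw [key]
  simp

theorem lift_stackAction_flatMap (M : Λ → TM2.Stmt Γ Λ σ) (T : Set (TM2.Stmt Γ Λ σ)) (ks : List K)
    (S S₀ : ∀ k, List (Γ k)) (P : (∀ k, List (Γ k)) → Prop) :
    FreeMonoid.lift (stackAction M T) (.ofList (ks.flatMap fun k => stackWord T k (S k))) P S₀ =
      P (fun k => if k ∈ ks then S k else S₀ k) := by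
  induction ks generalizing S₀ with
  | nil => simp [Function.End.one_def]
  | cons k ks ih =>
    rw [List.flatMap_cons, FreeMonoid.ofList_append, map_mul, Function.End.mul_apply,
      lift_stackAction_stackWord, ih]
    congr 1
    funext j
    by_cases h : j = k
    · subst h; simp
    · simp [h]

theorem haltsFrom_of_wordClass_eq {M : Λ → TM2.Stmt Γ Λ σ} {T : Set (TM2.Stmt Γ Λ σ)} {ks : List K}
    (hks : ∀ k, k ∈ ks) {q : T} {v : σ} {S : ∀ k, List (Γ k)}
    (h : wordClass (stackRels M T) (configWord T ks q v S) = wordClass (stackRels M T) [halted]) :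
    HaltsFrom M q v S := by
  have key := congrFun (congrFun (congrArg
    (PresentedMonoid.lift (stackAction M T) (stackAction_respects M T)) h)
      (fun _ => True)) S
  change FreeMonoid.lift (stackAction M T) (.ofList (configWord T ks q v S)) _ S = True at key
  rw [configWord, FreeMonoid.ofList_append, map_mul, Function.End.mul_apply,
    lift_stackAction_flatMap] at key
  simpa [hks, stackAction] using key

end Soundness

/-! ### Completeness: a halting computation gives a derivation. -/

theorem wordClass_append {A : Type*} (R : Set (FreeMonoid A × FreeMonoid A)) (u v : List A) :
    wordClass R (u ++ v) = wordClass R u * wordClass R v := rfl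

theorem wordClass_eq_prod {A : Type*} (R : Set (FreeMonoid A × FreeMonoid A)) (u : List A) :
    wordClass R u = (u.map fun a => wordClass R [a]).prod := by
  induction u with
  | nil => rfl
  | cons a u ih => rw [List.map_cons, List.prod_cons, ← ih]; rfl

theorem commute_wordClass {A : Type*} (R : Set (FreeMonoid A × FreeMonoid A)) {u v : List A}
    (h : ∀ a ∈ u, ∀ b ∈ v, Commute (wordClass R [a]) (wordClass R [b])) :
    Commute (wordClass R u) (wordClass R v) := by
  rw [wordClass_eq_prod R u, wordClass_eq_prod R v]
  refine Commute.list_prod_left _ _ fun x hx => Commute.list_prod_right _ _ fun y hy => ?_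
  obtain ⟨a, ha, rfl⟩ := List.mem_map.1 hx
  obtain ⟨b, hb, rfl⟩ := List.mem_map.1 hy
  exact h a ha b hb

section Completeness

variable {M : Λ → TM2.Stmt Γ Λ σ} {T : Set (TM2.Stmt Γ Λ σ)}

theorem wordClass_eq_of_stackRel {u v : List (StackLetter T)}
    (h : StackRel M T (.ofList u) (.ofList v)) :
    wordClass (stackRels M T) u = wordClass (stackRels M T) v :=
  PresentedMonoid.mk_eq_mk_of_rel (rels := fun u v => (u, v) ∈ stackRels M T) h

theorem exists_eq_stack_of_mem_stackWord {k : K} {l : List (Γ k)} {x : StackLetter T}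
    (hx : x ∈ stackWord T k l) : ∃ o, x = stack k o := by
  rcases List.mem_cons.1 hx with rfl | hx
  · exact ⟨none, rfl⟩
  · obtain ⟨a, -, rfl⟩ := List.mem_map.1 hx
    exact ⟨some a, rfl⟩

theorem stackWord_cons (k : K) (a : Γ k) (l : List (Γ k)) :
    stackWord T k (a :: l) = stackWord T k l ++ [stack k (some a)] := by
  simp [stackWord]

theorem exists_stackWord_eq (k : K) (l : List (Γ k)) :
    ∃ w, stackWord T k l = w ++ [stack k l.head?] := by
  cases l with
  | nil => exact ⟨[], rfl⟩
  | cons a l => exact ⟨_, stackWord_cons k a l⟩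

variable (M T) in
/-- Any stack can be moved next to the state letter. -/
theorem exists_flatMap_stackWord_eq [DecidableEq K] {ks : List K} (hks : ks.Nodup) {k : K}
    (hk : k ∈ ks) (S : ∀ k, List (Γ k)) :
    ∃ m, ∀ l, wordClass (stackRels M T) (ks.flatMap fun j => stackWord T j (update S k l j)) =
      m * wordClass (stackRels M T) (stackWord T k l) := by
  have aux : ∀ {ks : List K}, k ∉ ks → ∀ l,
      (ks.flatMap fun j => stackWord T j (update S k l j)) =
        ks.flatMap fun j => stackWord T j (S j) := by
    intro ks hk l
    refine List.flatMap_congr fun j hj => ?_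
    rw [Function.update_of_ne (ne_of_mem_of_not_mem hj hk)]
  induction ks with
  | nil => simp at hk
  | cons j ks ih =>
    rw [List.nodup_cons] at hks
    simp only [List.flatMap_cons, wordClass_append]
    by_cases hj : k = j
    · subst hj
      refine ⟨wordClass _ (ks.flatMap fun j => stackWord T j (S j)), fun l => ?_⟩
      rw [aux hks.1, Function.update_self]
      refine (commute_wordClass _ fun a ha b hb => ?_).eq
      obtain ⟨o, rfl⟩ := exists_eq_stack_of_mem_stackWord ha
      obtain ⟨i, hi, hb⟩ := List.mem_flatMap.1 hb
      obtain ⟨p, rfl⟩ := exists_eq_stack_of_mem_stackWord hb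
      exact wordClass_eq_of_stackRel (u := [_, _]) (v := [_, _])
        (.comm k i o p fun h => hks.1 (h ▸ hi))
    · obtain ⟨m, hm⟩ := ih hks.2 ((List.mem_cons.1 hk).resolve_left hj)
      refine ⟨wordClass _ (stackWord T j (S j)) * m, fun l => ?_⟩
      rw [hm, Function.update_of_ne (Ne.symm hj), mul_assoc]

theorem wordClass_append_halted (ks : List K) (S : ∀ k, List (Γ k)) :
    wordClass (stackRels M T) (ks.flatMap (fun k => stackWord T k (S k)) ++ [halted]) =
      wordClass (stackRels M T) [halted] := by
  have key : ∀ u : List (StackLetter T), (∀ x ∈ u, ∃ k o, x = stack k o) →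
      wordClass (stackRels M T) (u ++ [halted]) = wordClass (stackRels M T) [halted] := by
    intro u hu
    induction u with
    | nil => rfl
    | cons x u ih =>
      obtain ⟨k, o, rfl⟩ := hu x (by simp)
      rw [List.cons_append, ← List.singleton_append, wordClass_append,
        ih fun y hy => hu y (by simp [hy])]
      exact wordClass_eq_of_stackRel (u := [_, _]) (v := [_]) (.absorb k o)
  refine key _ fun x hx => ?_
  obtain ⟨k, -, hx⟩ := List.mem_flatMap.1 hx
  exact ⟨k, exists_eq_stack_of_mem_stackWord hx⟩

variable {ks : List K}

/-- A relation that involves the state letter only acts on configuration words. -/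
theorem configWord_eq_of_state {q q' : T} {v v' : σ} (S : ∀ k, List (Γ k))
    (h : StackRel M T (.of (state q v)) (.of (state q' v'))) :
    wordClass (stackRels M T) (configWord T ks q v S) =
      wordClass (stackRels M T) (configWord T ks q' v' S) := by
  rw [configWord, configWord, wordClass_append, wordClass_append,
    wordClass_eq_of_stackRel (u := [_]) (v := [_]) h]

/-- A relation that changes the state letter and one stack acts on configuration words. -/
theorem configWord_eq_of_stack [DecidableEq K] (hks : ks.Nodup) (hks' : ∀ k, k ∈ ks) {q q' : T}
    {v v' : σ} (S : ∀ k, List (Γ k)) (k : K) (l : List (Γ k))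
    (h : wordClass (stackRels M T) (stackWord T k (S k) ++ [state q v]) =
      wordClass (stackRels M T) (stackWord T k l ++ [state q' v'])) :
    wordClass (stackRels M T) (configWord T ks q v S) =
      wordClass (stackRels M T) (configWord T ks q' v' (update S k l)) := by
  -- The prefix `m` does not depend on the content of stack `k`, so it is the same before and after
  -- the operation.
  obtain ⟨m, hm⟩ := exists_flatMap_stackWord_eq M T hks (hks' k) S
  rw [configWord, configWord, wordClass_append, wordClass_append, hm]
  have hS := hm (S k)
  rw [Function.update_eq_self] at hS
  rw [hS, mul_assoc, mul_assoc]
  exact congrArg (m * ·) h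

variable [DecidableEq K]

open scoped Classical in
variable (M T ks) in
/-- The element of the presented monoid that is attached to a configuration of the machine. -/
noncomputable def cfgClass : TM2.Cfg Γ Λ σ → MonoidOfPresentation (stackRels M T)
  | ⟨none, _, _⟩ => wordClass _ [halted]
  | ⟨some l, v, S⟩ =>
    -- The default value is the halted class, so the induction over a computation closes trivially
    -- outside `T`.
    if h : M l ∈ T then wordClass _ (configWord T ks ⟨M l, h⟩ v S) else wordClass _ [halted]

/-- Induction on the statement: each constructor is simulated by its own relation, and closure of
`T` under substatements provides the next state letter. -/
theorem wordClass_configWord_eq_cfgClass (hks : ks.Nodup) (hks' : ∀ k, k ∈ ks)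
    (hT : ∀ q ∈ T, (TM2.stmts₁ q : Set (TM2.Stmt Γ Λ σ)) ⊆ T)
    (hgoto : ∀ f, TM2.Stmt.goto f ∈ T → ∀ v, M (f v) ∈ T) (q : T) (v : σ) (S : ∀ k, List (Γ k)) :
    wordClass (stackRels M T) (configWord T ks q v S) =
      cfgClass M T ks (TM2.stepAux q.1 v S) := by
  obtain ⟨q, hq⟩ := q
  induction q generalizing v S with
  | push k f q ih =>
    have hq' : q ∈ T := hT _ hq (by simp [TM2.stmts₁, TM2.stmts₁_self])
    rw [TM2.stepAux, ← ih _ _ hq']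
    refine configWord_eq_of_stack hks hks' S k _ ?_
    rw [stackWord_cons, List.append_assoc, wordClass_append, wordClass_append]
    congr 1
    exact wordClass_eq_of_stackRel (u := [_]) (v := [_, _]) (.push k f q hq hq' v)
  | peek k f q ih =>
    have hq' : q ∈ T := hT _ hq (by simp [TM2.stmts₁, TM2.stmts₁_self])
    rw [TM2.stepAux, ← ih _ _ hq']
    rw [configWord_eq_of_stack hks hks' S k (S k), Function.update_eq_self]
    -- The letter next to the state is the top entry, or the bottom marker if the stack is empty;
    -- this is the `Option` that `peek` reads.
    obtain ⟨w, hw⟩ := exists_stackWord_eq (T := T) k (S k)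
    rw [hw, List.append_assoc, List.append_assoc]
    exact congrArg (wordClass _ w * ·)
      (wordClass_eq_of_stackRel (u := [_, _]) (v := [_, _]) (.peek k f q hq hq' v _))
  | pop k f q ih =>
    have hq' : q ∈ T := hT _ hq (by simp [TM2.stmts₁, TM2.stmts₁_self])
    rw [TM2.stepAux, ← ih _ _ hq']
    refine configWord_eq_of_stack hks hks' S k _ ?_
    cases S k with
    | nil => exact wordClass_eq_of_stackRel (u := [_, _]) (v := [_, _]) (.pop_bottom k f q hq hq' v)
    | cons a l =>
      rw [stackWord_cons, List.append_assoc]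
      exact congrArg (wordClass _ (stackWord T k l) * ·)
        (wordClass_eq_of_stackRel (u := [_, _]) (v := [_]) (.pop k f q hq hq' v a))
  | load f q ih =>
    have hq' : q ∈ T := hT _ hq (by simp [TM2.stmts₁, TM2.stmts₁_self])
    rw [TM2.stepAux, ← ih _ _ hq']
    exact configWord_eq_of_state S (.load f q hq hq' v)
  | branch f q₁ q₂ ih₁ ih₂ =>
    have h₁ : q₁ ∈ T := hT _ hq (by simp [TM2.stmts₁, TM2.stmts₁_self])
    have h₂ : q₂ ∈ T := hT _ hq (by simp [TM2.stmts₁, TM2.stmts₁_self])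
    rw [TM2.stepAux]
    cases hf : f v with
    | true =>
      rw [cond_true, ← ih₁ _ _ h₁]; exact configWord_eq_of_state S (.branch_true f q₁ q₂ hq h₁ v hf)
    | false =>
      rw [cond_false, ← ih₂ _ _ h₂]
      exact configWord_eq_of_state S (.branch_false f q₁ q₂ hq h₂ v hf)
  | goto f =>
    rw [TM2.stepAux, cfgClass, dif_pos (hgoto f hq v)]
    exact configWord_eq_of_state S (.goto f hq v _)
  | halt =>
    rw [TM2.stepAux, cfgClass, configWord, wordClass_append,
      wordClass_eq_of_stackRel (u := [_]) (v := [_]) (.halt hq v), ← wordClass_append,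
      wordClass_append_halted]

theorem wordClass_eq_of_haltsFrom (hks : ks.Nodup) (hks' : ∀ k, k ∈ ks)
    (hT : ∀ q ∈ T, (TM2.stmts₁ q : Set (TM2.Stmt Γ Λ σ)) ⊆ T)
    (hgoto : ∀ f, TM2.Stmt.goto f ∈ T → ∀ v, M (f v) ∈ T) {q : T} {v : σ} {S : ∀ k, List (Γ k)}
    (h : HaltsFrom M q v S) :
    wordClass (stackRels M T) (configWord T ks q v S) = wordClass (stackRels M T) [halted] := by
  rw [wordClass_configWord_eq_cfgClass hks hks' hT hgoto]
  obtain ⟨b, hb⟩ := Part.dom_iff_mem.1 h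
  refine StateTransition.evalInduction (C := fun c => cfgClass M T ks c = _) hb fun c _ ih => ?_
  match c with
  | ⟨none, _, _⟩ => rfl
  | ⟨some l, v, S⟩ =>
    rw [cfgClass]
    split_ifs with hl
    · rw [wordClass_configWord_eq_cfgClass hks hks' hT hgoto]
      exact ih _ rfl
    · rfl

end Completeness

/-- The word problem of the presentation attached to a stack machine expresses halting. -/
theorem wordClass_eq_halted_iff [DecidableEq K] {M : Λ → TM2.Stmt Γ Λ σ}
    {T : Set (TM2.Stmt Γ Λ σ)} {ks : List K} (hks : ks.Nodup) (hks' : ∀ k, k ∈ ks)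
    (hT : ∀ q ∈ T, (TM2.stmts₁ q : Set (TM2.Stmt Γ Λ σ)) ⊆ T)
    (hgoto : ∀ f, TM2.Stmt.goto f ∈ T → ∀ v, M (f v) ∈ T) (q : T) (v : σ) (S : ∀ k, List (Γ k)) :
    wordClass (stackRels M T) (configWord T ks q v S) = wordClass (stackRels M T) [halted] ↔
      HaltsFrom M q v S :=
  ⟨haltsFrom_of_wordClass_eq hks', wordClass_eq_of_haltsFrom hks hks' hT hgoto⟩

end StackMachine

/-! ### Computability of the input encoding, and a universal program. -/

open Turing.PartrecToTM2

instance : Finite K' :=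
  Finite.of_surjective (![K'.main, K'.rev, K'.aux, K'.stack]) fun k => by
    cases k
    exacts [⟨0, rfl⟩, ⟨1, rfl⟩, ⟨2, rfl⟩, ⟨3, rfl⟩]

theorem Turing.PartrecToTM2.trNat_bit (b : Bool) {n : ℕ} (h : Nat.bit b n ≠ 0) :
    trNat (Nat.bit b n) = (if b then Γ'.bit1 else Γ'.bit0) :: trNat n := by
  have hn : n = 0 → b = true := fun h' => by cases b <;> simp_all
  rw [trNat, trNat, ← Num.ofNat'_eq, ← Num.ofNat'_eq, Num.ofNat'_bit]
  have h0 : Num.ofNat' n = 0 → n = 0 := fun h => by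
    rw [Num.ofNat'_eq] at h; exact_mod_cast h
  cases b with
  | true => cases Num.ofNat' n <;> rfl
  | false =>
    cases hm : Num.ofNat' n with
    | zero => exact absurd (hn (h0 hm)) (by simp)
    | pos p => rfl

theorem Turing.PartrecToTM2.trNat_of_ne_zero {n : ℕ} (h : n ≠ 0) :
    trNat n = (if n % 2 = 0 then Γ'.bit0 else Γ'.bit1) :: trNat (n / 2) := by
  have := trNat_bit n.bodd (n := n.div2) (by rwa [Nat.bit_bodd_div2])
  rw [Nat.bit_bodd_div2] at this
  rw [this, Nat.div2_val, Nat.mod_two_of_bodd]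
  cases n.bodd <;> rfl

/-- Binary digits are produced by strong recursion through n / 2. The arbitrary `g` means that only
the final alphabet needs an encoding. -/
theorem primrec_trNat_map {α : Type*} [Primcodable α] (g : Γ' → α) :
    Primrec fun n => (trNat n).map g := by
  have h : Primrec₂ fun (_ : Unit) (n : ℕ) => (trNat n).map g := by
    -- `L` lists the values at all smaller arguments, so its length is the current argument.
    refine Primrec.nat_strong_rec _ (g := fun _ L => if L.length = 0 then some [] else
      L[L.length / 2]?.map fun l => (if L.length % 2 = 0 then g Γ'.bit0 else g Γ'.bit1) :: l)
      ?_ ?_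
    · have hlen : Primrec fun p : Unit × List (List α) => p.2.length :=
        Primrec.list_length.comp Primrec.snd
      refine Primrec.ite (Primrec.eq.comp hlen (Primrec.const 0)) (Primrec.const _) ?_
      refine Primrec.option_map
        (Primrec.list_getElem?.comp Primrec.snd (Primrec.nat_div.comp hlen (Primrec.const 2))) ?_
      refine Primrec.list_cons.comp (Primrec.ite ?_ (Primrec.const _) (Primrec.const _)) Primrec.snd
      exact Primrec.eq.comp (Primrec.nat_mod.comp (hlen.comp Primrec.fst) (Primrec.const 2))
        (Primrec.const 0)
    · intro _ n
      rcases eq_or_ne n 0 with rfl | hn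
      · simp
      · have : n / 2 < n := Nat.div_lt_self (Nat.pos_of_ne_zero hn) one_lt_two
        simp only [List.length_map, List.length_range, hn, if_false, List.getElem?_map,
          List.getElem?_range this, Option.map_some, trNat_of_ne_zero hn, List.map_cons]
        split_ifs <;> rfl
  exact h.comp (Primrec.const ()) Primrec.id

/-- There is a program that halts exactly on the numbers of the programs that halt on `0`. -/
theorem exists_universal_halting_code : ∃ c : ToPartrec.Code, ∀ p : Nat.Partrec.Code,
    (c.eval [Encodable.encode p]).Dom ↔ (p.eval 0).Dom := by
  have hf : Partrec fun n : ℕ => (Denumerable.ofNat Nat.Partrec.Code n).eval 0 :=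
    Nat.Partrec.Code.eval_part.comp (Computable.ofNat _) (Computable.const 0)
  obtain ⟨c, hc⟩ := ToPartrec.Code.exists_code (Nat.Partrec'.part_iff₁.2 hf)
  refine ⟨c, fun p => ?_⟩
  have := hc ⟨[Encodable.encode p], rfl⟩
  rw [this]
  simp [List.Vector.head]

/-! ### The words for the universal program and the final reduction. -/

section Reduction

variable (c : ToPartrec.Code)

/-- The statements that the stack machine of the program `c` runs. -/
def programStmts : Set (TM2.Stmt (fun _ : K' => Γ') Λ' (Option Γ')) :=
  {q | some q ∈ TM2.stmts tr (codeSupp c Cont'.halt)}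

instance : Finite (programStmts c) :=
  Set.Finite.to_subtype <|
    ((TM2.stmts tr (codeSupp c Cont'.halt)).finite_toSet.preimage
      (Option.some_injective _).injOn)

theorem tr_mem_programStmts {l : Λ'} (h : l ∈ codeSupp c Cont'.halt) : tr l ∈ programStmts c := by
  simpa [programStmts, TM2.stmts] using! ⟨l, h, TM2.stmts₁_self⟩

theorem stmts₁_subset_programStmts : ∀ q ∈ programStmts c,
    (TM2.stmts₁ q : Set (TM2.Stmt (fun _ : K' => Γ') Λ' (Option Γ'))) ⊆ programStmts c :=
  fun _ hq _ h => TM2.stmts_trans h hq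

theorem goto_mem_programStmts (f : Option Γ' → Λ') (h : TM2.Stmt.goto f ∈ programStmts c)
    (v : Option Γ') : tr (f v) ∈ programStmts c :=
  tr_mem_programStmts c <|
    (@TM2.stmts_supportsStmt _ _ _ _ ⟨trNormal c Cont'.halt⟩ _ _ _ (tr_supports c Cont'.halt) h :
      TM2.SupportsStmt (codeSupp c Cont'.halt) (TM2.Stmt.goto f)) v

/-- The list of all stacks. -/
def stackList : List K' := [K'.main, K'.rev, K'.aux, K'.stack]

/-- The first statement that the stack machine of the program `c` runs. -/
def initialStmt : programStmts c :=
  ⟨tr (trNormal c Cont'.halt), tr_mem_programStmts c (tr_supports c Cont'.halt).1⟩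

/-- The word for the initial configuration of the program `c` on the input `n`. -/
def initialWord (n : ℕ) : List (StackLetter (programStmts c)) :=
  configWord (programStmts c) stackList (initialStmt c) none (K'.elim (trList [n]) [] [] [])

theorem wordClass_initialWord_iff (n : ℕ) :
    wordClass (stackRels tr (programStmts c)) (initialWord c n) =
      wordClass (stackRels tr (programStmts c)) [StackLetter.halted] ↔ (c.eval [n]).Dom := by
  rw [initialWord, wordClass_eq_halted_iff (by decide) (by intro k; cases k <;> decide)
    (stmts₁_subset_programStmts c) (goto_mem_programStmts c)]
  -- The initial configuration of the machine is what a `goto` to the starting label produces.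
  exact (haltsFrom_goto tr (fun _ => trNormal c Cont'.halt) none _).symm.trans
    (Iff.of_eq (congrArg Part.Dom (tr_eval c [n])))

theorem primrec_initialWord_map {α : Type*} [Primcodable α]
    (g : StackLetter (programStmts c) → α) : Primrec fun n => (initialWord c n).map g := by
  have h : ∀ n, (initialWord c n).map g =
      [g (.stack K'.main none), g (.stack K'.main (some Γ'.cons))] ++
        (((trNat n).map fun a => g (.stack K'.main (some a))).reverse ++
          [g (.stack K'.rev none), g (.stack K'.aux none), g (.stack K'.stack none),
            g (.state (initialStmt c) none)]) := by
    intro n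
    simp [initialWord, configWord, stackList, stackWord, Function.comp_def]
  refine Primrec.of_eq ?_ fun n => (h n).symm
  exact Primrec.list_append.comp (Primrec.const _) <| Primrec.list_append.comp
    (Primrec.list_reverse.comp (primrec_trNat_map _)) (Primrec.const _)

end Reduction

theorem map_comparisonWord {A B : Type*} (e : Option (Option A) → B) (u v : List A) :
    (comparisonWord u v).map e = e (some none) ::
      (u.map (fun a => e (some (some a))) ++ v.map fun _ => e none) := by
  simp [comparisonWord, Function.comp_def]

theorem mainTheorem2 :
    ∃ (n : ℕ) (R : Set (FreeMonoid (Fin n) × FreeMonoid (Fin n))),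
      R.Finite ∧ HomogeneousRels R ∧
        ¬ ComputablePred (OConjugacyProblem R) := by
  obtain ⟨c, hc⟩ := exists_universal_halting_code
  let R := stackRels tr (programStmts c)
  obtain ⟨n, ⟨e⟩⟩ := Finite.exists_equiv_fin (Option (Option (StackLetter (programStmts c))))
  refine ⟨n, renameRels e (paddedRels R),
    (paddedRels_finite (stackRels_finite tr (programStmts c))).image _,
    (paddedRels_homogeneous R).rename e, fun h => ComputablePred.halting_problem 0 ?_⟩
  let u := fun p : Nat.Partrec.Code => initialWord c (Encodable.encode p)
  -- The program `p` is sent to the comparison words of its initial configuration and the halted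
  -- letter, renamed into `Fin n`.
  refine ComputablePred.computable_of_manyOneReducible ⟨fun p =>
    ((comparisonWord (u p) [.halted]).map e, (comparisonWord [.halted] (u p)).map e), ?_,
    fun p => ?_⟩ h
  · have hu {α : Type} [Primcodable α] (g : StackLetter (programStmts c) → α) :
        Primrec fun p => (u p).map g := (primrec_initialWord_map c g).comp Primrec.encode
    simp only [map_comparisonWord]
    exact (Primrec.pair
      (Primrec.list_cons.comp (Primrec.const _)
        (Primrec.list_append.comp (hu _) (Primrec.const _)))
      (Primrec.list_cons.comp (Primrec.const _)
        (Primrec.list_append.comp (Primrec.const _) (hu _)))).to_comp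
  · rw [OConjugacyProblem, oConjugate_rename_iff, oConjugate_comparisonWord_iff,
      wordClass_initialWord_iff, hc]
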